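/- Let $G$ be a Polish group, let $H$ be an arbitrary topological group, and let $\pi\colon G\to H$ be a universally measurable group homomorphism, that is, for every open set $U\subseteq H$ the preimage $\pi^{-1}(U)$ is universally measurable: it is measurable with respect to (the completion of) every Borel probability measure on $G$. Then $\pi$ is continuous. -/

import Mathlib

open MeasureTheory

/-- A set is universally measurable if it is measurable with respect to (the completion of) every
probability measure on `X`. It is used for a topological space with its Borel σ-algebra. -/
def IsUniversallyMeasurableSet {X : Type*} [MeasurableSpace X] (A : Set X) : Prop :=
  ∀ μ : Measure X, IsProbabilityMeasure μ → NullMeasurableSet A μ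

/-- A map into a topological space is universally measurable if the preimages of open sets are
universally measurable. -/
def IsUniversallyMeasurableMap {X Y : Type*} [MeasurableSpace X] [TopologicalSpace Y]
    (f : X → Y) : Prop :=
  ∀ U : Set Y, IsOpen U → IsUniversallyMeasurableSet (f ⁻¹' U)

open Set Topology Filter Pointwise TopologicalSpace

/-! Suppose that no finitely many conjugates of `π ⁻¹' U`, by elements of a given neighborhood of
`1`, cover a neighborhood of `1`. By completeness there are letters whose infinite words converge
and which avoid all these conjugates by earlier words (`exists_seq_signProd`). The words push Haar
measure on `ℕ → ℤˣ` forward to `G`. Some translate of a smaller neighborhood `V` has non-null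
preimage (`exists_measure_preimage_translate_ne_zero`, which copes with any weight of `H`), so by
Steinhaus flipping one sign can preserve it. This puts a forbidden conjugate of a letter into the
preimage of `V * V⁻¹`, a contradiction.

The Neumann-type lemma turns a cover by conjugates into one by translates. Near `1`, conjugation is
then controlled by finitely many elements, so the conjugates can be removed. -/

/-! ### Null unions of arbitrary disjoint families -/

lemma measure_prod_eq_zero_of_section {X Y : Type*} [MeasurableSpace X] [MeasurableSpace Y]
    {μ : Measure X} {ν : Measure Y} [SFinite ν] {N : Set (X × Y)}
    (hN : NullMeasurableSet N (μ.prod ν)) (h : ∀ x, ν (Prod.mk x ⁻¹' N) = 0) :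
    (μ.prod ν) N = 0 := by
  obtain ⟨t, ht, hNt⟩ := hN
  rw [measure_congr hNt]
  refine Measure.measure_prod_null_of_ae_null ht ?_
  filter_upwards [Measure.ae_ae_of_ae_prod hNt] with x hx
  have : (Prod.mk x ⁻¹' N : Set Y) =ᵐ[ν] (Prod.mk x ⁻¹' t : Set Y) := hx
  rw [← measure_congr this]
  exact h x

lemma exists_seq_isOpen_superset_measure_iInter_zero {X : Type*} [TopologicalSpace X] [MeasurableSpace X]
    {μ : Measure X} [μ.OuterRegular] {A : Set X} (hA : μ A = 0) :
    ∃ U : ℕ → Set X, (∀ n, IsOpen (U n)) ∧ (∀ n, A ⊆ U n) ∧ μ (⋂ n, U n) = 0 := by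
  have h : ∀ n : ℕ, ∃ U ⊇ A, IsOpen U ∧ μ U < (n + 1 : ENNReal)⁻¹ := fun n ↦
    A.exists_isOpen_lt_of_lt _ (by rw [hA]; simp)
  choose U hAU hU hμ using h
  refine ⟨U, hU, hAU, ?_⟩
  by_contra hne
  obtain ⟨n, hn⟩ := ENNReal.exists_inv_nat_lt hne
  have h1 : μ (⋂ n, U n) ≤ (n + 1 : ENNReal)⁻¹ :=
    (measure_mono (iInter_subset U n)).trans (hμ n).le
  have h2 : (n + 1 : ENNReal)⁻¹ ≤ (n : ENNReal)⁻¹ := ENNReal.inv_le_inv.2 le_self_add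
  exact absurd (h1.trans h2) (not_le.2 hn)

/-- A disjoint family of null sets all of whose subfamilies have a measurable union has a null
union, whatever the cardinality of the family. -/
theorem measure_iUnion_null_of_pairwise_disjoint {X ι : Type*} [TopologicalSpace X]
    [SecondCountableTopology X] [MeasurableSpace X] [BorelSpace X] {μ : Measure X} [SFinite μ]
    [μ.OuterRegular] {E : ι → Set X} (hd : Pairwise (Function.onFun Disjoint E))
    (hm : ∀ S : Set ι, NullMeasurableSet (⋃ i ∈ S, E i) μ) (h0 : ∀ i, μ (E i) = 0) :
    μ (⋃ i, E i) = 0 := by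
  classical
  by_contra hne
  obtain ⟨_, _⟩ := exists_wellFoundedLT ι
  -- a set of indices with non-null union, all of whose initial segments have null union
  obtain ⟨S, hS, hseg⟩ : ∃ S : Set ι, μ (⋃ i ∈ S, E i) ≠ 0 ∧
      ∀ i ∈ S, μ (⋃ j ∈ Iio i, E j) = 0 := by
    by_cases h : ∃ i, μ (⋃ j ∈ Iio i, E j) ≠ 0
    · obtain ⟨i, hi, hmin⟩ := WellFounded.has_min (wellFounded_lt (α := ι))
        {i | μ (⋃ j ∈ Iio i, E j) ≠ 0} h
      exact ⟨Iio i, hi, fun j hj ↦ by_contra fun hj' ↦ hmin j hj' hj⟩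
    · push Not at h
      exact ⟨univ, by simpa using hne, fun i _ ↦ h i⟩
  have hseg' : ∀ i : S, μ (⋃ j ∈ Iic i.1, E j) = 0 := fun i ↦ by
    rw [← Iio_insert, biUnion_insert]
    exact measure_union_null (h0 i) (hseg i i.2)
  choose U hU hEU hμU using fun i : S ↦ exists_seq_isOpen_superset_measure_iInter_zero (hseg' i)
  -- Sierpiński's argument: `⋂ n, N n` contains the pairs whose second index is at most the first,
  -- yet its vertical sections are null.
  set N : ℕ → Set (X × X) := fun n ↦ ⋃ i : S, E i ×ˢ U i n with hN
  have hNm : ∀ n, NullMeasurableSet (N n) (μ.prod μ) := fun n ↦ by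
    -- Grouping by basic open sets leaves countably many rectangles; their first sides are unions of
    -- arbitrary subfamilies.
    have : N n = ⋃ O ∈ countableBasis X,
        (⋃ i ∈ {i : ι | ∃ h : i ∈ S, O ⊆ U ⟨i, h⟩ n}, E i) ×ˢ O := by
      ext ⟨x, y⟩
      simp only [hN, mem_iUnion, mem_prod, mem_ofPred_eq, exists_prop, Subtype.exists]
      constructor
      · rintro ⟨i, hi, hx, hy⟩
        obtain ⟨O, hO, hyO, hOU⟩ := (isBasis_countableBasis X).mem_nhds_iff.1
          ((hU ⟨i, hi⟩ n).mem_nhds hy)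
        exact ⟨O, hO, ⟨i, ⟨hi, hOU⟩, hx⟩, hyO⟩
      · rintro ⟨O, hO, ⟨i, ⟨hi, hOU⟩, hx⟩, hyO⟩
        exact ⟨i, hi, hx, hOU hyO⟩
    rw [this]
    exact NullMeasurableSet.biUnion (countable_countableBasis X) fun O hO ↦
      (hm _).prod (isOpen_of_mem_countableBasis hO).measurableSet.nullMeasurableSet
  have hnull : (μ.prod μ) (⋂ n, N n) = 0 := by
    refine measure_prod_eq_zero_of_section (NullMeasurableSet.iInter hNm) fun x ↦ ?_
    by_cases hx : ∃ i : S, x ∈ E i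
    · obtain ⟨i, hi⟩ := hx
      refine measure_mono_null (fun y hy ↦ ?_) (hμU i)
      simp only [hN, mem_preimage, mem_iInter, mem_iUnion, mem_prod] at hy ⊢
      intro n
      obtain ⟨j, hj, hyj⟩ := hy n
      have : j = i := by
        by_contra hji
        exact disjoint_left.1 (hd (fun h ↦ hji (Subtype.ext h))) hj hi
      exact this ▸ hyj
    · convert measure_empty (μ := μ)
      ext y
      simp only [hN, mem_preimage, mem_iInter, mem_iUnion, mem_prod, mem_empty_iff_false, iff_false]
      intro hy
      obtain ⟨j, hj, -⟩ := hy 0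
      exact hx ⟨j, hj⟩
  have hswap : (μ.prod μ) (Prod.swap ⁻¹' ⋂ n, N n) = 0 :=
    (Measure.measurePreserving_swap (μ := μ) (ν := μ)).quasiMeasurePreserving.preimage_null hnull
  have hsub : (⋃ i ∈ S, E i) ×ˢ (⋃ i ∈ S, E i) ⊆ (⋂ n, N n) ∪ (Prod.swap ⁻¹' ⋂ n, N n) := by
    rintro ⟨x, y⟩ ⟨hx, hy⟩
    simp only [mem_iUnion, exists_prop] at hx hy
    obtain ⟨i, hi, hx⟩ := hx
    obtain ⟨j, hj, hy⟩ := hy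
    rcases le_total j i with hji | hij
    · refine Or.inl (mem_iInter.2 fun n ↦ mem_iUnion.2 ⟨⟨i, hi⟩, hx, hEU ⟨i, hi⟩ n ?_⟩)
      exact mem_biUnion (show j ∈ Iic i from hji) hy
    · refine Or.inr (mem_iInter.2 fun n ↦ mem_iUnion.2 ⟨⟨j, hj⟩, hy, hEU ⟨j, hj⟩ n ?_⟩)
      exact mem_biUnion (show i ∈ Iic j from hij) hx
  have := measure_mono_null hsub (measure_union_null hnull hswap)
  rw [Measure.prod_prod, mul_self_eq_zero] at this
  exact hS this

/-! ### Measures and translates in a group of any weight -/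

/-- Inside a neighborhood of the identity there is a sequence of sets, each of which contains a
uniform thickening of its predecessor. -/
lemma exists_thickening_chain {H : Type*} [Group H] [TopologicalSpace H] [IsTopologicalGroup H]
    {U : Set H} (hU : U ∈ 𝓝 1) :
    ∃ Q W : ℕ → Set H, (1 : H) ∈ Q 0 ∧ (∀ n, IsOpen (W n)) ∧ (∀ n, (1 : H) ∈ W n) ∧
      (∀ n, (W n)⁻¹ * W n * Q n ⊆ Q (n + 1)) ∧ ∀ n, W n * Q n ⊆ U := by
  have step : ∀ V : {V : Set H // IsOpen V ∧ (1 : H) ∈ V},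
      ∃ V' : {V : Set H // IsOpen V ∧ (1 : H) ∈ V}, V'.1⁻¹ * V'.1 ⊆ V ∧ V'.1 * V'.1 ⊆ V := by
    rintro ⟨V, hVo, hV1⟩
    obtain ⟨T, hTo, hT1, hTV⟩ := exists_open_nhds_one_mul_subset (hVo.mem_nhds hV1)
    refine ⟨⟨T ∩ T⁻¹, hTo.inter hTo.inv, hT1, by simpa using hT1⟩, ?_, ?_⟩
    · refine (mul_subset_mul ?_ inter_subset_left).trans hTV
      rw [inter_inv, inv_inv]
      exact inter_subset_right
    · exact (mul_subset_mul inter_subset_left inter_subset_left).trans hTV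
  choose next hnext hnext' using step
  let V : ℕ → {V : Set H // IsOpen V ∧ (1 : H) ∈ V} := fun n ↦
    Nat.rec ⟨interior U, isOpen_interior, mem_interior_iff_mem_nhds.2 hU⟩ (fun _ ↦ next) n
  have hV : ∀ n, (V (n + 1)).1⁻¹ * (V (n + 1)).1 ⊆ (V n).1 := fun n ↦ hnext (V n)
  have hV' : ∀ n, (V (n + 1)).1 * (V (n + 1)).1 ⊆ (V n).1 := fun n ↦ hnext' (V n)
  let Q : ℕ → Set H := fun n ↦ Nat.rec (V 1).1 (fun k q ↦ (V (k + 2)).1 * q) n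
  have hQ : ∀ n, Q (n + 1) = (V (n + 2)).1 * Q n := fun n ↦ rfl
  have hsub : ∀ n, (V (n + 1)).1 * Q n ⊆ (V 0).1 := fun n ↦ by
    induction n with
    | zero => exact hV' 0
    | succ n ih =>
      rw [hQ, ← mul_assoc]
      exact (mul_subset_mul_right (hV' (n + 1))).trans ih
  have hanti : ∀ n, (V (n + 1)).1 ⊆ (V n).1 := fun n ↦
    (subset_mul_left _ (V (n + 1)).2.2).trans (hV' n)
  refine ⟨Q, fun n ↦ (V (n + 3)).1, (V 1).2.2, fun n ↦ (V (n + 3)).2.1, fun n ↦ (V (n + 3)).2.2, fun n ↦ ?_,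
    fun n ↦ ?_⟩
  · rw [hQ]
    exact mul_subset_mul_right (hV (n + 2))
  · refine (mul_subset_mul_right ((hanti (n + 2)).trans (hanti (n + 1)))).trans ?_
    exact (hsub n).trans interior_subset

/-- A nonzero measure cannot vanish on all the preimages of the right translates of a neighborhood
of the identity of a topological group, whatever the weight of that group. -/
theorem exists_measure_preimage_translate_ne_zero {X H : Type*} [TopologicalSpace X]
    [SecondCountableTopology X] [MeasurableSpace X] [BorelSpace X] {μ : Measure X} [SFinite μ]
    [μ.OuterRegular] (hμ : μ ≠ 0) [Group H] [TopologicalSpace H] [IsTopologicalGroup H]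
    {f : X → H} (hf : ∀ O : Set H, IsOpen O → NullMeasurableSet (f ⁻¹' O) μ)
    {U : Set H} (hU : U ∈ 𝓝 1) : ∃ h : H, μ (f ⁻¹' (U * {h})) ≠ 0 := by
  classical
  by_contra! hcon
  obtain ⟨Q, W, hQ1, hWo, hW1, hWQ, hQU⟩ := exists_thickening_chain hU
  obtain ⟨_, _⟩ := exists_wellFoundedLT H
  -- As in Stone's paracompactness proof, a point goes to the least `h` whose translates reach it at
  -- any level; `W n` then thickens without creating overlaps at level `n`.
  set C : ℕ → H → Set H := fun n h ↦ {x | x ∈ Q n * {h} ∧ ∀ h' < h, ∀ m, x ∉ Q m * {h'}} with hC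
  set P : ℕ → H → Set H := fun n h ↦ W n * C n h with hP
  have hPo : ∀ n h, IsOpen (P n h) := fun n h ↦ (hWo n).mul_right
  have hPU : ∀ n h, P n h ⊆ U * {h} := fun n h ↦ by
    have : P n h ⊆ W n * (Q n * {h}) := mul_subset_mul_left fun x hx ↦ hx.1
    rw [← mul_assoc] at this
    exact this.trans (mul_subset_mul_right (hQU n))
  have hdis : ∀ n h h', h' < h → Disjoint (P n h) (P n h') := fun n h h' hlt ↦ by
    rw [disjoint_left]
    rintro y ⟨w, hw, x, hx, rfl⟩ ⟨w', hw', x', hx', heq⟩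
    obtain ⟨q, hq, z, hz, rfl⟩ := hx'.1
    refine hx.2 h' hlt (n + 1) ⟨w⁻¹ * w' * q, hWQ n ?_, z, hz, ?_⟩
    · exact mul_mem_mul (mul_mem_mul (inv_mem_inv.2 hw) hw') hq
    · simp only at heq ⊢
      rw [mul_assoc, mul_assoc, heq, inv_mul_cancel_left]
  have hnull : ∀ n, μ (⋃ h, f ⁻¹' P n h) = 0 := fun n ↦ by
    refine measure_iUnion_null_of_pairwise_disjoint (fun h h' hne ↦ ?_) (fun S ↦ ?_) fun h ↦ ?_
    · refine Disjoint.preimage f ?_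
      rcases lt_or_gt_of_ne hne with hlt | hlt
      · exact (hdis n h' h hlt).symm
      · exact hdis n h h' hlt
    · rw [← preimage_iUnion₂]
      exact hf _ (isOpen_biUnion fun h _ ↦ hPo n h)
    · exact measure_mono_null (preimage_mono (hPU n h)) (hcon h)
  have hcov : (⋃ n, ⋃ h, f ⁻¹' P n h) = univ := by
    refine eq_univ_of_forall fun x ↦ ?_
    obtain ⟨h, ⟨m, hm⟩, hmin⟩ := WellFounded.has_min (wellFounded_lt (α := H))
      {h | ∃ m, f x ∈ Q m * {h}} ⟨f x, 0, 1, hQ1, f x, rfl, one_mul _⟩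
    refine mem_iUnion.2 ⟨m, mem_iUnion.2 ⟨h, 1, hW1 m, f x, ⟨hm, fun h' hlt k hk ↦ ?_⟩, one_mul _⟩⟩
    exact hmin h' ⟨k, hk⟩ hlt
  refine hμ (Measure.measure_univ_eq_zero.1 ?_)
  rw [← hcov]
  exact measure_iUnion_null hnull

/-! ### From conjugates to translates -/

/-- The analogue for subsets of a topological group of B. H. Neumann's lemma on groups covered by
finitely many cosets. -/
theorem exists_nhds_subset_translates_of_finite_cover {G ι : Type*} [Group G] [TopologicalSpace G]
    [IsTopologicalGroup G] (A : ι → Set G) (s : Finset ι) (E : Finset G) {O : Set G}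
    (hO : O ∈ 𝓝 1) (hcov : ∀ x ∈ O, ∃ i ∈ s, ∃ e ∈ E, e⁻¹ * x ∈ A i) :
    ∃ i ∈ s, ∃ E' : Finset G, ∃ O' ∈ 𝓝 (1 : G), ∀ x ∈ O', ∃ e ∈ E',
      e⁻¹ * x ∈ A i * (A i)⁻¹ * A i := by
  classical
  induction s using Finset.induction_on generalizing E O with
  | empty => simpa using hcov 1 (mem_of_mem_nhds hO)
  | insert i s _ ih =>
    by_cases hi : ∃ O' ∈ 𝓝 (1 : G), ∀ x ∈ O', ∃ e ∈ E, e⁻¹ * x ∈ A i * (A i)⁻¹ * A i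
    · exact ⟨i, Finset.mem_insert_self i s, E, hi⟩
    · push Not at hi
      obtain ⟨O', hO', hOO⟩ : ∃ O' ∈ 𝓝 (1 : G), ∀ x ∈ O', ∀ y ∈ O', ∀ z ∈ O', x * y⁻¹ * z ∈ O := by
        have : Tendsto (fun p : G × G × G ↦ p.1 * p.2.1⁻¹ * p.2.2) (𝓝 1 ×ˢ 𝓝 1 ×ˢ 𝓝 1) (𝓝 1) := by
          have h : Continuous fun p : G × G × G ↦ p.1 * p.2.1⁻¹ * p.2.2 := by fun_prop
          simpa [nhds_prod_eq] using h.tendsto (1, 1, 1)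
        obtain ⟨T, hT, T', hT', hTT⟩ := mem_prod_iff.1 (this hO)
        obtain ⟨T₁, hT₁, T₂, hT₂, hTT'⟩ := mem_prod_iff.1 hT'
        exact ⟨T ∩ (T₁ ∩ T₂), inter_mem hT (inter_mem hT₁ hT₂), fun x hx y hy z hz ↦
          hTT (show (x, y, z) ∈ T ×ˢ T' from ⟨hx.1, hTT' ⟨hy.2.1, hz.2.2⟩⟩)⟩
      obtain ⟨g, hg, hgE⟩ := hi O' hO'
      -- For `x` and `p e` in the same translate of `A i`, the choice of `g` keeps `g * (p e)⁻¹ * x`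
      -- out of every `e'`-translate of `A i`, so another `A k` catches it.
      have hp : ∀ e : G, ∃ p : G, ∀ x ∈ O', e⁻¹ * x ∈ A i → p ∈ O' ∧ e⁻¹ * p ∈ A i := fun e ↦ by
        by_cases h : ∃ x ∈ O', e⁻¹ * x ∈ A i
        · exact h.imp fun p hp _ _ _ ↦ hp
        · exact ⟨1, fun x hx hxA ↦ (h ⟨x, hx, hxA⟩).elim⟩
      choose p hp using hp
      suffices h : ∀ x ∈ O', ∃ j ∈ s, ∃ e ∈ E ∪ Finset.image₂ (fun e e' ↦ p e * g⁻¹ * e') E E,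
          e⁻¹ * x ∈ A j by
        obtain ⟨j, hj, h⟩ := ih _ hO' h
        exact ⟨j, Finset.mem_insert_of_mem hj, h⟩
      intro x hx
      have hx' : x ∈ O := by simpa using hOO x hx x hx x hx
      obtain ⟨j, hj, e, he, hxe⟩ := hcov x hx'
      rcases Finset.mem_insert.1 hj with rfl | hj
      · obtain ⟨hpO, hpA⟩ := hp e x hx hxe
        obtain ⟨k, hk, e', he', hke⟩ := hcov _ (hOO g hg (p e) hpO x hx)
        rcases Finset.mem_insert.1 hk with rfl | hk
        · refine (hgE e' he' ⟨_, mul_mem_mul hke (inv_mem_inv.2 hxe), e⁻¹ * p e, hpA, ?_⟩).elim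
          simp only
          group
        · refine ⟨k, hk, p e * g⁻¹ * e', Finset.mem_union_right _
            (Finset.mem_image₂_of_mem he he'), ?_⟩
          convert hke using 1
          group
      · exact ⟨j, hj, e, Finset.mem_union_left _ he, hxe⟩

/-! ### Words indexed by the Cantor group -/

/-- Steinhaus: the quotient set of a measurable non-null subset of `E` is a neighborhood of `1`. -/
lemma exists_mul_mem_of_haar_ne_zero {K : Type*} [Group K] [TopologicalSpace K]
    [IsTopologicalGroup K] [CompactSpace K] [MeasurableSpace K] [BorelSpace K]
    {μ : Measure K} [μ.IsHaarMeasure]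
    [μ.InnerRegularCompactLTTop] {E : Set K} (hE : NullMeasurableSet E μ) (hE0 : μ E ≠ 0)
    {u : ℕ → K} (hu : Tendsto u atTop (𝓝 1)) : ∃ n, ∃ k ∈ E, u n * k ∈ E := by
  obtain ⟨t, htE, ht, hteq⟩ := hE.exists_measurable_subset_ae_eq
  have hpos : 0 < μ t := by
    rw [measure_congr hteq]
    exact pos_iff_ne_zero.2 hE0
  obtain ⟨n, hn⟩ := (hu.eventually 
    (Measure.div_mem_nhds_one_of_haar_pos_ne_top μ t ht hpos (measure_ne_top μ t))).exists
  obtain ⟨a, ha, b, hb, hab⟩ := hn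
  exact ⟨n, b, htE hb, by rw [← hab]; simpa using htE ha⟩

/-- The partial products of the word `∏ g i ^ (ε i)`, where a sign `-1` selects the letter. -/
def signProd {G : Type*} [Monoid G] (g : ℕ → G) (ε : ℕ → ℤˣ) : ℕ → G
  | 0 => 1
  | n + 1 => signProd g ε n * if ε n = 1 then 1 else g n

lemma continuous_signProd {G : Type*} [Monoid G] [TopologicalSpace G] [ContinuousMul G]
    (g : ℕ → G) (n : ℕ) : Continuous fun ε ↦ signProd g ε n := by
  induction n with
  | zero => exact continuous_const
  | succ n ih =>
    exact ih.mul ((continuous_of_discreteTopology (f := fun e : ℤˣ ↦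
      if e = 1 then (1 : G) else g n)).comp (continuous_apply n))

lemma signProd_congr {G : Type*} [Monoid G] (g : ℕ → G) {ε δ : ℕ → ℤˣ} {n : ℕ}
    (h : ∀ i < n, ε i = δ i) : signProd g ε n = signProd g δ n := by
  induction n with
  | zero => rfl
  | succ n ih =>
    simp only [signProd]
    rw [ih fun i hi ↦ h i (hi.trans n.lt_succ_self), h n n.lt_succ_self]

/-- Flipping one sign multiplies all later partial products by a fixed conjugate of a letter. -/
lemma signProd_flip {G : Type*} [Group G] (g : ℕ → G) (ε : ℕ → ℤˣ) (n : ℕ) :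
    ∃ c, (c = signProd g ε n * g n * (signProd g ε n)⁻¹ ∨
        c = (signProd g ε n * g n * (signProd g ε n)⁻¹)⁻¹) ∧
      ∀ m, signProd g (Pi.mulSingle n (-1) * ε) (n + 1 + m) = c * signProd g ε (n + 1 + m) := by
  set δ : ℕ → ℤˣ := Pi.mulSingle n (-1) * ε with hδ
  have hne : ∀ i, i ≠ n → δ i = ε i := fun i hi ↦ by simp [hδ, Pi.mulSingle_eq_of_ne hi]
  have hn : δ n = -ε n := by simp [hδ]
  have hlow : signProd g δ n = signProd g ε n := signProd_congr g fun i hi ↦ hne i hi.ne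
  have key : ∀ c, signProd g δ (n + 1) = c * signProd g ε (n + 1) →
      ∀ m, signProd g δ (n + 1 + m) = c * signProd g ε (n + 1 + m) := fun c hc m ↦ by
    induction m with
    | zero => exact hc
    | succ m ih =>
      rw [← add_assoc, signProd, signProd, ih, hne (n + 1 + m) (by omega), mul_assoc]
  rcases Int.units_eq_one_or (ε n) with h | h
  · refine ⟨_, Or.inl rfl, key _ ?_⟩
    simp [signProd, hlow, hn, h]
  · refine ⟨_, Or.inr rfl, key _ ?_⟩
    simp [signProd, hlow, hn, h, mul_assoc]

/-- If no finite set of conjugates, by elements of the open set `W`, of `B` covers a neighborhood of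
the identity, then there is a sequence whose finite words all stay in `W`, whose
infinite words converge and whose letters avoid all these conjugates by earlier words. -/
lemma exists_seq_signProd {G : Type*} [Group G] [TopologicalSpace G] [IsTopologicalGroup G]
    [IsCompletelyMetrizableSpace G] {W : Set G} (hW : IsOpen W) (hW1 : (1 : G) ∈ W) {B : Set G}
    (hB : ∀ F : Finset G, ↑F ⊆ W → {x | ∃ f ∈ F, f * x * f⁻¹ ∈ B} ∉ 𝓝 1) :
    ∃ g : ℕ → G, (∀ ε, ∃ y, Tendsto (signProd g ε) atTop (𝓝 y)) ∧
      ∀ ε n, signProd g ε n * g n * (signProd g ε n)⁻¹ ∉ B := by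
  classical
  let := upgradeIsCompletelyMetrizable G
  have step : ∀ (n : ℕ) (D : {D : Finset G // (D : Set G) ⊆ W}), ∃ g : G,
      ∀ a ∈ D.1, a * g ∈ W ∧ dist a (a * g) < 1 / 2 / 2 ^ n ∧ a * g * a⁻¹ ∉ B := by
    rintro n ⟨D, hD⟩
    have h1 : ∀ᶠ g in 𝓝 (1 : G), ∀ a ∈ D, a * g ∈ W ∧ dist a (a * g) < 1 / 2 / 2 ^ n := by
      refine (Finset.eventually_all D).2 fun a ha ↦ ?_
      have ht : Tendsto (fun g ↦ a * g) (𝓝 1) (𝓝 a) := by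
        simpa using (continuous_const_mul a).tendsto 1
      refine (ht.eventually (hW.mem_nhds (hD ha))).and ?_
      have := ht.eventually (Metric.ball_mem_nhds a (show (0 : ℝ) < 1 / 2 / 2 ^ n by positivity))
      simpa [Metric.mem_ball, dist_comm] using this
    by_contra! hcon
    refine hB D hD (mem_of_superset h1 fun g hg ↦ ?_)
    obtain ⟨a, ha, h⟩ := hcon g
    exact ⟨a, ha, h (hg a ha).1 (hg a ha).2⟩
  choose next hnext using step
  -- `D n` holds all words of length `n`; finiteness lets one letter serve every `ε`.
  let D : ℕ → {D : Finset G // (D : Set G) ⊆ W} := fun n ↦ Nat.rec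
    ⟨{1}, by simpa using hW1⟩
    (fun n D ↦ ⟨D.1 ∪ D.1.image (· * next n D), by
      intro x hx
      simp only [Finset.coe_union, Finset.coe_image, mem_union, mem_image, Finset.mem_coe] at hx
      rcases hx with hx | ⟨a, ha, rfl⟩
      · exact D.2 hx
      · exact (hnext n D a ha).1⟩) n
  have hD : ∀ n, (D (n + 1)).1 = (D n).1 ∪ (D n).1.image (· * next n (D n)) := fun n ↦ rfl
  have hmem : ∀ ε n, signProd (fun n ↦ next n (D n)) ε n ∈ (D n).1 := fun ε n ↦ by
    induction n with
    | zero => exact Finset.mem_singleton_self 1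
    | succ n ih =>
      rw [hD, signProd]
      split_ifs
      · exact Finset.mem_union_left _ (by simpa using ih)
      · exact Finset.mem_union_right _ (Finset.mem_image_of_mem _ ih)
  refine ⟨fun n ↦ next n (D n), fun ε ↦ ?_, fun ε n ↦ (hnext n (D n) _ (hmem ε n)).2.2⟩
  refine cauchySeq_tendsto_of_complete (cauchySeq_of_le_geometric_two (C := 1) fun n ↦ ?_)
  rw [signProd]
  split_ifs
  · rw [mul_one, dist_self]
    positivity
  · exact (hnext n (D n) _ (hmem ε n)).2.1.le

/-- The preimage of a neighborhood of the identity under a universally measurable homomorphism has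
finitely many conjugates that together cover a neighborhood of the identity. -/
theorem exists_finite_conj_preimage_mem_nhds {G : Type*} [Group G] [TopologicalSpace G]
    [IsTopologicalGroup G] [PolishSpace G] [MeasurableSpace G] [BorelSpace G]
    {H : Type*} [Group H] [TopologicalSpace H] [IsTopologicalGroup H]
    {π : G →* H} (hπ : IsUniversallyMeasurableMap π) {U : Set H} (hU : U ∈ 𝓝 1) {W : Set G}
    (hW : W ∈ 𝓝 1) :
    ∃ F : Finset G, ↑F ⊆ W ∧ {x | ∃ f ∈ F, π (f * x * f⁻¹) ∈ U} ∈ 𝓝 1 := by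
  by_contra! hcon
  obtain ⟨V, hVo, hV1, hVU⟩ : ∃ V : Set H, IsOpen V ∧ (1 : H) ∈ V ∧ V * V⁻¹ ⊆ U := by
    obtain ⟨T, hTo, hT1, hTU⟩ := exists_open_nhds_one_mul_subset hU
    refine ⟨T ∩ T⁻¹, hTo.inter hTo.inv, ⟨hT1, by simpa using hT1⟩, ?_⟩
    refine (mul_subset_mul inter_subset_left ?_).trans hTU
    rw [inter_inv, inv_inv]
    exact inter_subset_right
  obtain ⟨g, hconv, hg⟩ := exists_seq_signProd (B := π ⁻¹' (V * V⁻¹)) isOpen_interior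
    (mem_interior_iff_mem_nhds.2 hW) fun F hF hmem ↦ hcon F (hF.trans interior_subset)
      (mem_of_superset hmem fun x ⟨f, hf, hx⟩ ↦ ⟨f, hf, hVU hx⟩)
  choose φ hφ using hconv
  let : MeasurableSpace (ℕ → ℤˣ) := borel _
  have : BorelSpace (ℕ → ℤˣ) := ⟨rfl⟩
  let μ : Measure (ℕ → ℤˣ) := Measure.haarMeasure ⊤
  have : IsProbabilityMeasure μ := ⟨Measure.haarMeasure_self⟩
  have hφm : Measurable φ := measurable_of_tendsto_metrizable
    (fun n ↦ (continuous_signProd g n).measurable) (tendsto_pi_nhds.2 hφ)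
  have : IsProbabilityMeasure (μ.map φ) := Measure.isProbabilityMeasure_map hφm.aemeasurable
  obtain ⟨h, hh⟩ := exists_measure_preimage_translate_ne_zero (μ := μ.map φ)
    (IsProbabilityMeasure.ne_zero _) (fun O hO ↦ hπ O hO _ inferInstance) (hVo.mem_nhds hV1)
  have hnm : NullMeasurableSet (π ⁻¹' (V * {h})) (μ.map φ) :=
    hπ _ hVo.mul_right _ inferInstance
  have hu : Tendsto (fun n ↦ (Pi.mulSingle n (-1) : ℕ → ℤˣ)) atTop (𝓝 1) := by
    refine tendsto_pi_nhds.2 fun i ↦ tendsto_const_nhds.congr' ?_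
    filter_upwards [eventually_gt_atTop i] with n hn
    rw [Pi.mulSingle_eq_of_ne hn.ne]
    rfl
  obtain ⟨n, ε, hε, hδ⟩ := exists_mul_mem_of_haar_ne_zero
    (hnm.preimage (hφm.measurePreserving μ).quasiMeasurePreserving)
    (by rwa [Measure.map_apply₀ hφm.aemeasurable hnm] at hh) hu
  obtain ⟨c, hc, hflip⟩ := signProd_flip g ε n
  have hφc : φ (Pi.mulSingle n (-1) * ε) = c * φ ε := by
    have h1 : Tendsto (fun m ↦ n + 1 + m) atTop atTop := 
      tendsto_atTop_mono (fun m ↦ Nat.le_add_left m (n + 1)) tendsto_id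
    refine tendsto_nhds_unique ((hφ (Pi.mulSingle n (-1) * ε)).comp h1) ?_
    simp only [Function.comp_def, hflip]
    exact ((hφ ε).comp h1).const_mul c
  obtain ⟨v, hv, _, rfl, hvε⟩ := hε
  obtain ⟨w, hw, _, rfl, hwδ⟩ := hδ
  simp only [hφc, map_mul] at hvε hwδ
  have hcw : π c = w * v⁻¹ := by
    rw [← hvε, ← mul_assoc, mul_left_inj] at hwδ
    rw [hwδ, mul_inv_cancel_right]
  refine hg ε n ?_
  -- `V * V⁻¹` is symmetric, so the direction of the flip is irrelevant.
  rcases hc with rfl | rfl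
  · exact ⟨w, hw, v⁻¹, inv_mem_inv.2 hv, hcw.symm⟩
  · refine ⟨v, hv, w⁻¹, inv_mem_inv.2 hw, ?_⟩
    rw [map_inv, inv_eq_iff_eq_inv] at hcw
    rw [hcw, mul_inv_rev, inv_inv]

lemma exists_symm_nhds_one_mul_mul_subset {H : Type*} [Group H] [TopologicalSpace H]
    [IsTopologicalGroup H] {U : Set H} (hU : U ∈ 𝓝 1) :
    ∃ V ∈ 𝓝 (1 : H), (∀ v ∈ V, v⁻¹ ∈ V) ∧ ∀ x ∈ V, ∀ y ∈ V, ∀ z ∈ V, x * y * z ∈ U := by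
  obtain ⟨V, hV, h⟩ := exists_nhds_one_split4 hU
  refine ⟨V ∩ V⁻¹, inter_mem hV (inv_mem_nhds_one H hV), fun v hv ↦ ⟨hv.2, by simpa using hv.1⟩,
    fun x hx y hy z hz ↦ ?_⟩
  simpa using h hx.1 hy.1 hz.1 (mem_of_mem_nhds hV)

/-- Finitely many left translates of the preimage of a neighborhood of the identity under a
universally measurable homomorphism cover a neighborhood of the identity. -/
theorem exists_finite_translates_preimage {G : Type*} [Group G] [TopologicalSpace G]
    [IsTopologicalGroup G] [PolishSpace G] [MeasurableSpace G] [BorelSpace G]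
    {H : Type*} [Group H] [TopologicalSpace H] [IsTopologicalGroup H]
    {π : G →* H} (hπ : IsUniversallyMeasurableMap π) {U : Set H} (hU : U ∈ 𝓝 1) :
    ∃ E : Finset G, ∃ O ∈ 𝓝 (1 : G), ∀ x ∈ O, ∃ e ∈ E, π (e⁻¹ * x) ∈ U := by
  classical
  obtain ⟨V, hV, hVi, hVU⟩ := exists_symm_nhds_one_mul_mul_subset hU
  obtain ⟨F, -, hF⟩ := exists_finite_conj_preimage_mem_nhds hπ hV (univ_mem (f := 𝓝 (1 : G)))
  obtain ⟨f, -, E, O, hO, hOE⟩ := exists_nhds_subset_translates_of_finite_cover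
    (fun f : G ↦ {x | π (f * x * f⁻¹) ∈ V}) F {1} hF (fun x hx ↦ by simpa using hx)
  -- Conjugating by `f` turns the set chosen by the lemma back into `π ⁻¹' V`.
  refine ⟨E.image fun e ↦ f * e * f⁻¹, (fun x ↦ f⁻¹ * x * f) ⁻¹' O, ?_, fun x hx ↦ ?_⟩
  · refine ContinuousAt.preimage_mem_nhds (by fun_prop) ?_
    simpa using hO
  · obtain ⟨e, he, a, ⟨b, hb, c, hc, rfl⟩, d, hd, h⟩ := hOE _ hx
    refine ⟨_, Finset.mem_image_of_mem _ he, ?_⟩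
    have hx' : (f * e * f⁻¹)⁻¹ * x = (f * b * f⁻¹) * (f * c⁻¹ * f⁻¹)⁻¹ * (f * d * f⁻¹) := by
      simp only at h
      calc (f * e * f⁻¹)⁻¹ * x = f * (e⁻¹ * (f⁻¹ * x * f)) * f⁻¹ := by group
        _ = _ := by rw [← h]; group
    rw [hx', map_mul, map_mul, map_inv]
    exact hVU _ hb _ (hVi _ hc) _ hd

theorem mainTheorem7 {G : Type*} [Group G] [TopologicalSpace G] [IsTopologicalGroup G]
    [PolishSpace G] [MeasurableSpace G] [BorelSpace G]
    {H : Type*} [Group H] [TopologicalSpace H] [IsTopologicalGroup H]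
    (π : G →* H) (hπ : IsUniversallyMeasurableMap π) :
    Continuous π := by
  refine continuous_of_continuousAt_one π fun U hU ↦ ?_
  rw [map_one] at hU
  obtain ⟨V, hV, hVi, hVU⟩ := exists_symm_nhds_one_mul_mul_subset hU
  obtain ⟨E, O, hO, hOE⟩ := exists_finite_translates_preimage hπ hV
  -- conjugation by elements of `O` is equicontinuous for the topology pulled back from `H`
  have hV' : {y | ∀ e ∈ E, (π e)⁻¹ * y * π e ∈ V} ∈ 𝓝 (1 : H) := by
    refine (Finset.eventually_all E).2 fun e _ ↦ ?_
    refine ContinuousAt.preimage_mem_nhds (f := fun y ↦ (π e)⁻¹ * y * π e) (by fun_prop) ?_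
    simpa using hV
  -- Taking `F` inside `O` makes each `f` a product of some `e ∈ E` and an element that `π` sends
  -- into `V`.
  obtain ⟨F, hFO, hF⟩ := exists_finite_conj_preimage_mem_nhds hπ hV' hO
  refine mem_map.2 (mem_of_superset hF ?_)
  rintro y ⟨f, hf, hy⟩
  obtain ⟨e, he, hef⟩ := hOE f (hFO hf)
  have h := hVU _ (hVi _ hef) _ (hy e he) _ hef
  have hy' : π y = (π (e⁻¹ * f))⁻¹ * ((π e)⁻¹ * π (f * y * f⁻¹) * π e) * π (e⁻¹ * f) := by
    simp only [map_mul, map_inv]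
    group
  rw [mem_preimage, hy']
  exact h
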